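/- Let $K$ be a field of characteristic $p\ge 0$ and let $\theta$ be an automorphism of $K$ of finite order $r$ with fixed field $F$; assume $p\nmid r$. Let $F^{\mathrm s}$ be a separable closure of $F$. Let $\mathcal A=K[X^{\pm1};\theta]$ be the skew Laurent polynomial ring, $Xa=\theta(a)X$ for $a\in K$; put $Y=X^r$, $\mathcal Z=F[Y^{\pm1}]$ (the centre of $\mathcal A$), $\mathcal C=K[Y^{\pm1}]$, and let $\mathrm{Frac}(\mathcal A)=F(Y)\otimes_{\mathcal Z}\mathcal A=F(Y)\otimes_{F[Y]}K[X;\theta]$ be the skew fraction field. For $0\le j<r$ let $\sec_j:\mathrm{Frac}(\mathcal A)\to K(Y)$ be the $F(Y)$-linear extension of $\sec_j\big(\sum_i a_iX^i\big)=\sum_i a_{j+ir}Y^i$. Let $z\in F^{\mathrm s}$, $z\ne0$, with minimal polynomial $N\in F[Y]$ over $F$. Let $\tau_{z,\mathrm{can}}:\mathcal A\to(\mathcal A/N\mathcal A)[[T]]$ be the morphism of $K$-algebras with $X\mapsto\left(1+T/Y\right)^{1/r}X$, where $Y$ denotes the class of $Y$ in $\mathcal Z/N\mathcal Z$ and $(1+T/Y)^{1/r}$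 is the power series over $\mathcal Z/N\mathcal Z$ with constant term $1$ whose $r$-th power is $1+T/Y$ (so $\tau_{z,\mathrm{can}}(Y)=Y+T$). It extends to $\mathrm{TS}_{z,\mathrm{can}}:\mathrm{Frac}(\mathcal A)\to(\mathcal A/N\mathcal A)((T))$. The canonical skew residue $\mathrm{sres}_{z,\mathrm{can}}(f)\in\mathcal A/N\mathcal A$ is the coefficient of $T^{-1}$ in $\mathrm{TS}_{z,\mathrm{can}}(f)$, and the canonical $j$-th partial skew residue is $$\mathrm{sres}_{z,j,\mathrm{can}}(f)=\iota_z\big(\sec_j(\mathrm{sres}_{z,\mathrm{can}}(f))\big)\in K\otimes_FF^{\mathrm s},$$ where $\sec_j:\mathcal A/N\mathcal A\to\mathcal C/N\mathcal C$ is induced by $\sec_j$ and $\iota_z:\mathcal C/N\mathcal C\to K\otimes_FF^{\mathrm s}$ sends $aY^i$ to $a\otimes z^i$. Let $K(y)$ be the (commutative) field of rational functions in a variable $y$, into which $K(Y)$ embeds by $Y\mapsto y^r$. For $\zeta\in F^{\mathrm s}$ let $\rho_\zeta:K(y)\,dy\to K\otimes_FF^{\mathrm s}$ be the $K$-linear map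 obtained from the classical residue $\mathrm{res}_\zeta:F(y)\,dy\to F^{\mathrm s}$ at $\zeta$ by extension of scalars from $F$ to $K$ (recall $K\otimes_FF(y)=K(y)$). Then for every $f\in\mathrm{Frac}(\mathcal A)$, every $j\in\{0,1,\dots,r-1\}$, every $z\in F^{\mathrm s}$ with $z\neq0$, and every $\zeta\in F^{\mathrm s}$ with $\zeta^r=z$, $$\mathrm{sres}_{z,j,\mathrm{can}}(f)=r\,\zeta^{-j}\,\rho_\zeta\big(y^{j+r-1}\,\sec_j(f)\,dy\big)\quad\text{in }K\otimes_FF^{\mathrm s}.$$ -/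

import Mathlib

open Polynomial TensorProduct
open scoped nonZeroDivisors

noncomputable section

namespace SkewRes

universe u v w

section Skew

variable {F : Type u} {K : Type v} [Field F] [Field K] [Algebra F K]

/-- The monoid `{1, X, X², …}` of powers of the skew variable attached to `θ`
(multiplicatively written natural numbers); it acts on `K` through the powers of `θ`. -/
def XPow (_θ : K ≃ₐ[F] K) : Type := Multiplicative ℕ

instance (θ : K ≃ₐ[F] K) : CommMonoid (XPow θ) :=
  inferInstanceAs (CommMonoid (Multiplicative ℕ))

instance (θ : K ≃ₐ[F] K) : MulSemiringAction (XPow θ) K :=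
  MulSemiringAction.compHom K (powersHom (K ≃ₐ[F] K) θ : Multiplicative ℕ →* (K ≃ₐ[F] K))

/-- The skew polynomial ring `K[X; θ]`: polynomials `∑ aᵢ Xⁱ` with the rule `X a = θ(a) X`. -/
abbrev SkewPoly (θ : K ≃ₐ[F] K) : Type v := SkewMonoidAlgebra K (XPow θ)

variable (θ : K ≃ₐ[F] K)

/-- The power `Xⁿ`, as an element of the monoid of exponents. -/
def xpow (n : ℕ) : XPow θ := Multiplicative.ofAdd n

/-- The exponent of a power of `X`. -/
def expo (x : XPow θ) : ℕ := Multiplicative.toAdd (α := ℕ) x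

/-- The monomial `a Xⁿ`. -/
def mono (n : ℕ) (a : K) : SkewPoly θ := SkewMonoidAlgebra.single (xpow θ n) a

theorem xpow_smul (n : ℕ) (a : K) : xpow θ n • a = (θ ^ n) a := rfl

theorem xpow_mul (m n : ℕ) : xpow θ m * xpow θ n = xpow θ (m + n) := rfl

theorem mono_mul_mono (m n : ℕ) (a b : K) :
    mono θ m a * mono θ n b = mono θ (m + n) (a * (θ ^ m) b) := by
  rw [mono, mono, SkewMonoidAlgebra.single_mul_single, xpow_mul, xpow_smul, mono]

/-- Multiplication rule of the skew variable: `X a = θ(a) X`. -/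
theorem X_mul_const (a : K) : mono θ 1 1 * mono θ 0 a = mono θ 0 (θ a) * mono θ 1 1 := by
  simp [mono_mul_mono]

theorem mono_induction {p : SkewPoly θ → Prop} (f : SkewPoly θ) (h0 : p 0)
    (hadd : ∀ g h, p g → p h → p (g + h)) (hm : ∀ n a, p (mono θ n a)) : p f := by
  induction f using SkewMonoidAlgebra.induction_on with
  | zero => exact h0
  | single g a => exact hm (expo θ g) a
  | add f g hf hg => exact hadd f g hf hg

/-- The embedding `F[Y] → K[X; θ]`, `Y ↦ X^r`, where `r` is the order of `θ`. -/
def centre : F[X] →+* SkewPoly θ :=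
  eval₂RingHom' (SkewMonoidAlgebra.singleOneRingHom.comp (algebraMap F K))
    (mono θ (orderOf θ) 1) (by
      intro a
      change mono θ 0 (algebraMap F K a) * mono θ (orderOf θ) 1 =
        mono θ (orderOf θ) 1 * mono θ 0 (algebraMap F K a)
      simp [mono_mul_mono])

theorem centre_monomial (n : ℕ) (c : F) :
    centre θ (monomial n c) = mono θ (n * orderOf θ) (algebraMap F K c) := by
  have h : ∀ n : ℕ, (mono θ (orderOf θ) (1 : K)) ^ n = mono θ (n * orderOf θ) 1 := by
    intro n
    induction n with
    | zero => rw [pow_zero, Nat.zero_mul]; rfl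
    | succ n ih => rw [pow_succ, ih, mono_mul_mono]; simp [Nat.succ_mul]
  have h2 : centre θ (monomial n c) =
      mono θ 0 (algebraMap F K c) * (mono θ (orderOf θ) (1 : K)) ^ n :=
    eval₂_monomial _ _
  rw [h2, h, mono_mul_mono]
  simp

theorem centre_mul_mono (m n : ℕ) (c : F) (a : K) :
    centre θ (monomial m c) * mono θ n a =
      mono θ (m * orderOf θ + n) (algebraMap F K c * a) := by
  rw [centre_monomial, mono_mul_mono, mul_comm m, pow_mul, pow_orderOf_eq_one, one_pow]
  rfl

theorem centre_commutes (P : F[X]) (f : SkewPoly θ) : centre θ P * f = f * centre θ P := by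
  induction P using Polynomial.induction_on' with
  | add p q hp hq => rw [map_add, add_mul, mul_add, hp, hq]
  | monomial m c =>
    induction f using mono_induction with
    | h0 => simp
    | hadd g h hg hh => rw [mul_add, add_mul, hg, hh]
    | hm n a =>
      rw [centre_mul_mono, centre_monomial, mono_mul_mono, AlgEquiv.commutes, add_comm, mul_comm a]

/-- `K[X; θ]` is an algebra over its central subring `F[Y]`, `Y = X^r`. -/
instance : Algebra F[X] (SkewPoly θ) := (centre θ).toAlgebra' (centre_commutes θ)

theorem smul_def' (P : F[X]) (f : SkewPoly θ) : P • f = centre θ P * f := rfl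

/-- The skew fraction field `Frac(K[X; θ]) = F(Y) ⊗_{F[Y]} K[X; θ]`; it is also the fraction field
of the skew Laurent polynomial ring `K[X^{±1}; θ]`. -/
abbrev SkewFrac : Type (max u v) := RatFunc F ⊗[F[X]] SkewPoly θ

/-- The section operator `sec_j : K[X; θ] → K[Y]`, `∑ aᵢ Xⁱ ↦ ∑ᵢ a_{j + ir} Yⁱ`. -/
def sec (j : ℕ) : SkewPoly θ →+ K[X] :=
  (Finsupp.liftAddHom fun x : XPow θ =>
    if j ≤ expo θ x ∧ orderOf θ ∣ expo θ x - j then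
      (monomial ((expo θ x - j) / orderOf θ) : K →ₗ[K] K[X]).toAddMonoidHom
    else 0).comp
  (SkewMonoidAlgebra.coeffAddEquiv (k := K) (G := XPow θ)).toAddMonoidHom

theorem sec_mono (j n : ℕ) (a : K) :
    sec θ j (mono θ n a) =
      if j ≤ n ∧ orderOf θ ∣ n - j then monomial ((n - j) / orderOf θ) a else 0 := by
  have : sec θ j (mono θ n a) =
      (if j ≤ n ∧ orderOf θ ∣ n - j then
      (monomial ((n - j) / orderOf θ) : K →ₗ[K] K[X]).toAddMonoidHom else 0) a := by
    change Finsupp.liftAddHom _ (Finsupp.single (xpow θ n) a) = _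
    rw [Finsupp.liftAddHom_apply_single]
    rfl
  rw [this]
  split_ifs <;> rfl

theorem coeff_sec (hr : 0 < orderOf θ) (j i : ℕ) (f : SkewPoly θ) :
    (sec θ j f).coeff i = f.coeff (xpow θ (j + i * orderOf θ)) := by
  classical
  induction f using mono_induction with
  | h0 => simp
  | hadd g h hg hh => simp [hg, hh]
  | hm n a =>
    rw [sec_mono, mono, SkewMonoidAlgebra.coeff_single_apply]
    have key : (xpow θ n = xpow θ (j + i * orderOf θ)) ↔ n = j + i * orderOf θ := Iff.rfl
    simp only [key]
    split_ifs with h1 h2 h2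
    · subst h2
      rw [Nat.add_sub_cancel_left, Nat.mul_div_cancel _ hr, coeff_monomial_same]
    · rw [coeff_monomial_of_ne]
      rintro rfl
      apply h2
      rw [Nat.div_mul_cancel h1.2]
      omega
    · exact absurd ⟨by omega, ⟨i, by rw [h2, Nat.add_sub_cancel_left, mul_comm]⟩⟩ h1
    · simp

theorem sec_centre_mul (hr : 0 < orderOf θ) (j : ℕ) (hj : j < orderOf θ) (P : F[X])
    (f : SkewPoly θ) : sec θ j (centre θ P * f) = P.map (algebraMap F K) * sec θ j f := by
  induction P using Polynomial.induction_on' with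
  | add p q hp hq => rw [map_add, add_mul, map_add, hp, hq, Polynomial.map_add, add_mul]
  | monomial m c =>
    induction f using mono_induction with
    | h0 => simp
    | hadd g h hg hh => rw [mul_add, map_add, hg, hh, map_add, mul_add]
    | hm n a =>
      rw [centre_mul_mono, sec_mono, sec_mono, Polynomial.map_monomial]
      have hjn : (j ≤ m * orderOf θ + n ∧ orderOf θ ∣ m * orderOf θ + n - j) ↔
          (j ≤ n ∧ orderOf θ ∣ n - j) := by
        constructor
        · rintro ⟨h1, h2⟩
          have h3 : j ≤ n := by
            by_contra hlt
            obtain ⟨k, hk⟩ := h2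
            rcases Nat.lt_or_ge k m with hkm | hkm
            · have : orderOf θ * (k + 1) ≤ orderOf θ * m := Nat.mul_le_mul_left _ hkm
              rw [mul_add, mul_one, mul_comm _ m] at this
              omega
            · have : orderOf θ * m ≤ orderOf θ * k := Nat.mul_le_mul_left _ hkm
              rw [mul_comm _ m] at this
              omega
          refine ⟨h3, ?_⟩
          rw [Nat.add_sub_assoc h3] at h2
          exact (Nat.dvd_add_right (Dvd.intro_left m rfl)).1 h2
        · rintro ⟨h1, h2⟩
          refine ⟨by omega, ?_⟩
          rw [Nat.add_sub_assoc h1]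
          exact dvd_add (Dvd.intro_left m rfl) h2
      simp only [hjn]
      split_ifs with h
      · rw [monomial_mul_monomial, Nat.add_sub_assoc h.1, Nat.add_comm (m * orderOf θ),
          Nat.add_mul_div_right _ _ hr, Nat.add_comm]
      · simp

end Skew

section Rational

variable (F : Type u) (K : Type v) [Field F] [Field K] [Algebra F K]

theorem map_mem_nonZeroDivisors :
    F[X]⁰ ≤ K[X]⁰.comap (mapRingHom (algebraMap F K)) :=
  nonZeroDivisors_le_comap_nonZeroDivisors_of_injective _
    (Polynomial.map_injective _ (algebraMap F K).injective)

/-- Extension of scalars of rational functions, `F(Y) → K(Y)`. -/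
def ratMap : RatFunc F →+* RatFunc K :=
  RatFunc.mapRingHom (mapRingHom (algebraMap F K)) (map_mem_nonZeroDivisors F K)

theorem ratMap_algebraMap (P : F[X]) :
    ratMap F K (algebraMap F[X] (RatFunc F) P) =
      algebraMap K[X] (RatFunc K) (P.map (algebraMap F K)) := by
  have := RatFunc.map_apply_div (mapRingHom (algebraMap F K)) (map_mem_nonZeroDivisors F K) P 1
  simpa [ratMap, RatFunc.coe_mapRingHom_eq_coe_map] using this

theorem ratMap_C (c : F) : ratMap F K (RatFunc.C c) = RatFunc.C (algebraMap F K c) := by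
  rw [← RatFunc.algebraMap_C, ratMap_algebraMap, Polynomial.map_C, RatFunc.algebraMap_C]

/-- The natural map `K ⊗_F F(y) → K(y)`, `a ⊗ q ↦ a q`. -/
def scalarExt : K ⊗[F] RatFunc F →ₗ[F] RatFunc K :=
  TensorProduct.lift <| LinearMap.mk₂ F
    (fun (a : K) (q : RatFunc F) => RatFunc.C a * ratMap F K q)
    (by intros; rw [map_add, add_mul])
    (by
      intro c a q
      rw [Algebra.smul_def, Algebra.smul_def, map_mul, mul_assoc]; rfl)
    (by intros; rw [map_add, mul_add])
    (by
      intro c a q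
      rw [Algebra.smul_def, Algebra.smul_def, map_mul, mul_left_comm, RatFunc.algebraMap_eq_C,
        ratMap_C]; rfl)

theorem scalarExt_tmul (a : K) (q : RatFunc F) :
    scalarExt F K (a ⊗ₜ q) = RatFunc.C a * ratMap F K q := rfl

theorem scalarExt_bijective (h : Algebra.IsAlgebraic F K) :
    Function.Bijective (scalarExt F K) := by
  let _ : Algebra F[X] K[X] := Polynomial.algebra F K
  let _ : Algebra (RatFunc F) (RatFunc K) := (ratMap F K).toAlgebra
  have halg (P : F[X]) : algebraMap F[X] (RatFunc K) P =
      algebraMap K[X] (RatFunc K) (P.map (algebraMap F K)) := by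
    rw [IsScalarTower.algebraMap_apply F[X] K[X] (RatFunc K)]; rfl
  have : IsScalarTower F[X] (RatFunc F) (RatFunc K) := IsScalarTower.of_algebraMap_eq (fun P => by
    rw [RingHom.algebraMap_toAlgebra, ratMap_algebraMap, halg])
  have : Algebra.IsPushout F[X] (RatFunc F) K[X] (RatFunc K) := inferInstance
  have : IsScalarTower F (RatFunc F) (RatFunc K) := IsScalarTower.of_algebraMap_eq (fun P => by
    rw [RatFunc.algebraMap_eq_C, RingHom.algebraMap_toAlgebra, ratMap_C]; rfl)
  have := (Algebra.IsPushout.comp_iff F F[X] K K[X] (T := RatFunc F) (T' := RatFunc K)).mpr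
    inferInstance
  have := this.symm
  have key : ∀ x, scalarExt F K x = Algebra.IsPushout.equiv F K (RatFunc F) (RatFunc K) x := by
    intro x
    induction x with
    | zero => simp
    | add x y hx hy => rw [map_add, map_add, hx, hy]
    | tmul a q => rw [Algebra.IsPushout.equiv_tmul]; rfl
  rw [show ⇑(scalarExt F K) = ⇑(Algebra.IsPushout.equiv F K (RatFunc F) (RatFunc K)) from
    funext key]
  exact AlgEquiv.bijective _

/-- The isomorphism `K ⊗_F F(y) ≃ K(y)` for `K / F` algebraic. -/
def scalarExtEquiv (h : Algebra.IsAlgebraic F K) : K ⊗[F] RatFunc F ≃ₗ[F] RatFunc K :=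
  LinearEquiv.ofBijective (scalarExt F K) (scalarExt_bijective F K h)

end Rational

section Subst

variable {K : Type v} [Field K]

/-- The embedding `K(Y) → K(y)`, `Y ↦ y^r`. -/
def substPow (r : ℕ) (hr : 0 < r) : RatFunc K →+* RatFunc K :=
  RatFunc.mapRingHom (expand K r : K[X] →+* K[X])
    (nonZeroDivisors_le_comap_nonZeroDivisors_of_injective _ (expand_injective hr))

end Subst

section Residue

variable {F : Type u} {L : Type w} [Field F] [Field L] [Algebra F L]

/-- The expansion at the point `c` of a polynomial `P`: the series `P(c + T)`. -/
def polyTaylor (c : L) : F[X] →+* LaurentSeries L :=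
  eval₂RingHom ((HahnSeries.C : L →+* LaurentSeries L).comp (algebraMap F L))
    (HahnSeries.C c + HahnSeries.single 1 1)

theorem polyTaylor_eq (c : L) (P : F[X]) :
    polyTaylor c P = HahnSeries.ofPowerSeries ℤ L
      ((taylor c (P.map (algebraMap F L)) : L[X]) : PowerSeries L) := by
  induction P using Polynomial.induction_on' with
  | add p q hp hq =>
    rw [map_add, hp, hq, Polynomial.map_add, map_add, Polynomial.coe_add, map_add]
  | monomial n a =>
    have : polyTaylor c (monomial n a) =
        HahnSeries.C (algebraMap F L a) * (HahnSeries.C c + HahnSeries.single 1 1) ^ n :=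
      eval₂_monomial _ _
    rw [this, Polynomial.map_monomial, taylor_monomial, Polynomial.coe_mul, Polynomial.coe_pow,
      Polynomial.coe_add, Polynomial.coe_C, Polynomial.coe_C, Polynomial.coe_X, map_mul, map_pow,
      map_add, HahnSeries.ofPowerSeries_C, HahnSeries.ofPowerSeries_C, HahnSeries.ofPowerSeries_X,
      add_comm]

theorem polyTaylor_injective (c : L) :
    Function.Injective (polyTaylor c : F[X] →+* LaurentSeries L) := by
  intro P Q h
  rw [polyTaylor_eq, polyTaylor_eq] at h
  exact Polynomial.map_injective _ (algebraMap F L).injective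
    (taylor_injective c (Polynomial.coe_injective L (HahnSeries.ofPowerSeries_injective h)))

/-- The Laurent expansion at the point `c` of a rational function `q` over `F`:
the series `q(c + T) ∈ L((T))`. -/
def ratTaylor (c : L) : RatFunc F →+* LaurentSeries L :=
  RatFunc.liftRingHom (polyTaylor c)
    (nonZeroDivisors_le_comap_nonZeroDivisors_of_injective _ (polyTaylor_injective c))

theorem ratTaylor_algebraMap (c : L) (P : F[X]) :
    ratTaylor c (algebraMap F[X] (RatFunc F) P) = polyTaylor c P :=
  RatFunc.liftRingHom_algebraMap _ _ _

/-- The classical residue at `c` of the differential form `q(y) dy`: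
the coefficient of `T⁻¹` in `q(c + T)`. -/
def residue (c : L) : RatFunc F →ₗ[F] L where
  toFun q := (ratTaylor c q).coeff (-1)
  map_add' p q := by rw [map_add, HahnSeries.coeff_add]
  map_smul' a q := by
    have h : ratTaylor c (algebraMap F (RatFunc F) a) =
        HahnSeries.C (algebraMap F L a) := by
      rw [RatFunc.algebraMap_eq_C, ← RatFunc.algebraMap_C, ratTaylor_algebraMap]
      exact eval₂_C _ _
    rw [Algebra.smul_def, map_mul, h, HahnSeries.C_mul_eq_smul, HahnSeries.coeff_smul,
      smul_eq_mul, RingHom.id_apply, Algebra.smul_def]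

/-- The map `ρ_c : K(y) dy → K ⊗_F L` obtained from the residue `F(y) dy → L` at `c`
by extending scalars from `F` to `K`. -/
def rho {K : Type v} [Field K] [Algebra F K] (h : Algebra.IsAlgebraic F K) (c : L) :
    RatFunc K →ₗ[F] K ⊗[F] L :=
  (LinearMap.lTensor K (residue c)).comp (scalarExtEquiv F K h).symm.toLinearMap

end Residue

section SeriesRoot

variable {L : Type w} [Field L]

theorem exists_seriesRoot (r : ℕ) (hr : (r : L) ≠ 0) (u : PowerSeries L)
    (hu : PowerSeries.constantCoeff u = 1) :
    ∃ v : PowerSeries L, PowerSeries.constantCoeff v = 1 ∧ v ^ r = u := by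
  have hr0 : r ≠ 0 := by rintro rfl; simp at hr
  have hmem : ∀ w : PowerSeries L, w ∈ Ideal.span {(PowerSeries.X : PowerSeries L)} ↔
      PowerSeries.constantCoeff w = 0 := fun w => by
    rw [Ideal.mem_span_singleton, PowerSeries.X_dvd_iff]
  obtain ⟨v, hv, hv1⟩ := HenselianRing.is_henselian (R := PowerSeries L)
    (I := Ideal.span {PowerSeries.X}) (X ^ r - C u) (monic_X_pow_sub_C u hr0) 1
    (by rw [hmem]; simp [hu])
    (by
      refine IsUnit.map _ ?_
      rw [PowerSeries.isUnit_iff_constantCoeff]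
      simpa [derivative_X_pow] using hr)
  rw [hmem, map_sub, map_one, sub_eq_zero] at hv1
  refine ⟨v, hv1, ?_⟩
  simpa [IsRoot, sub_eq_zero] using hv

theorem seriesRoot_unique (r : ℕ) (hr : (r : L) ≠ 0) (v w : PowerSeries L)
    (hv : PowerSeries.constantCoeff v = 1) (hw : PowerSeries.constantCoeff w = 1)
    (h : v ^ r = w ^ r) : v = w := by
  have h1 : (∑ i ∈ Finset.range r, v ^ i * w ^ (r - 1 - i)) * (v - w) = 0 := by
    rw [(Commute.all v w).geom_sum₂_mul, h, sub_self]
  rcases mul_eq_zero.1 h1 with h2 | h2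
  · have h3 := congrArg PowerSeries.constantCoeff h2
    simp [hv, hw] at h3
    exact absurd h3 hr
  · exact sub_eq_zero.1 h2

/-- The series `(1 + a T)^{1/r} ∈ L[[T]]`, when `r` is invertible in `L`: the unique power series
with constant term `1` whose `r`-th power is `1 + a T`. -/
def binomialRoot (r : ℕ) (hr : (r : L) ≠ 0) (a : L) : PowerSeries L :=
  (exists_seriesRoot r hr (1 + PowerSeries.C a * PowerSeries.X) (by simp)).choose

theorem binomialRoot_spec (r : ℕ) (hr : (r : L) ≠ 0) (a : L) :
    PowerSeries.constantCoeff (binomialRoot r hr a) = 1 ∧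
      binomialRoot r hr a ^ r = 1 + PowerSeries.C a * PowerSeries.X :=
  (exists_seriesRoot r hr (1 + PowerSeries.C a * PowerSeries.X) (by simp)).choose_spec

end SeriesRoot

section Canonical

variable {F : Type u} {K : Type v} {Fs : Type w} [Field F] [Field K] [Algebra F K]
  [Field Fs] [Algebra F Fs] [IsSepClosure F Fs]

instance (z : Fs) : Fact (Irreducible (minpoly F z)) :=
  ⟨minpoly.irreducible (Algebra.IsSeparable.isIntegral F z)⟩

variable (F) in
/-- The field `F[Y] / N`, where `N` is the minimal polynomial of `z` over `F`. -/
abbrev ResField (z : Fs) : Type u := AdjoinRoot (minpoly F z)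

variable (F) in
/-- The class of `Y` in `F[Y] / N`. -/
def classY (z : Fs) : ResField F z := AdjoinRoot.root (minpoly F z)

theorem classY_ne_zero {z : Fs} (hz : z ≠ 0) : classY F z ≠ 0 := by
  intro h
  apply hz
  have h0 : (minpoly F z).eval₂ (algebraMap F Fs) z = 0 := minpoly.aeval F z
  have h1 := congrArg (AdjoinRoot.lift (algebraMap F Fs) z h0) h
  rwa [classY, AdjoinRoot.lift_root, map_zero] at h1

variable (θ : K ≃ₐ[F] K) (z : Fs)

/-- The ideal of `K[X; θ]` generated by the central element `N(X^r)`. -/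
def idealN : Ideal (SkewPoly θ) := Ideal.span {centre θ (minpoly F z)}

theorem mem_idealN {f : SkewPoly θ} :
    f ∈ idealN θ z ↔ ∃ g, g * centre θ (minpoly F z) = f :=
  Ideal.mem_span_singleton'

instance : (idealN θ z).IsTwoSided := by
  refine ⟨fun {a} b ha => ?_⟩
  obtain ⟨g, rfl⟩ := (mem_idealN θ z).1 ha
  exact (mem_idealN θ z).2 ⟨g * b, by rw [mul_assoc, mul_assoc, centre_commutes]⟩

/-- The quotient ring `K[X; θ] / N K[X; θ]`. When `z ≠ 0` the class of `X` in it is invertible, so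
this is also the quotient by `N` of the skew Laurent polynomial ring `K[X^{±1}; θ]`. -/
abbrev SkewQuot : Type v := SkewPoly θ ⧸ idealN θ z

/-- The inclusion of `F[Y] / N` in `K[X; θ] / N K[X; θ]`. -/
def resToQuot : ResField F z →+* SkewQuot θ z :=
  Ideal.Quotient.lift (Ideal.span {minpoly F z})
    ((Ideal.Quotient.mk (idealN θ z)).comp (centre θ)) (by
      intro P hP
      obtain ⟨Q, rfl⟩ := Ideal.mem_span_singleton'.1 hP
      rw [RingHom.comp_apply, Ideal.Quotient.eq_zero_iff_mem, map_mul]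
      exact (mem_idealN θ z).2 ⟨_, rfl⟩)

theorem resToQuot_mk (P : F[X]) :
    resToQuot θ z (AdjoinRoot.mk (minpoly F z) P) = Ideal.Quotient.mk (idealN θ z) (centre θ P) :=
  rfl

theorem resToQuot_commutes (x : ResField F z) (f : SkewQuot θ z) :
    resToQuot θ z x * f = f * resToQuot θ z x := by
  obtain ⟨P, rfl⟩ := AdjoinRoot.mk_surjective x
  obtain ⟨g, rfl⟩ := Ideal.Quotient.mk_surjective f
  rw [resToQuot_mk, ← map_mul, ← map_mul, centre_commutes]

variable {θ} in
theorem natCast_ne_zero_resField (hr : (orderOf θ : F) ≠ 0) : (orderOf θ : ResField F z) ≠ 0 := by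
  intro h
  apply hr
  apply (algebraMap F (ResField F z)).injective
  rw [map_natCast, h, map_zero]

variable {θ} (hr : (orderOf θ : F) ≠ 0)

/-- The series `C_can = (1 + T / Y)^{1/r}` with coefficients in `F[Y] / N`. -/
def seriesC : PowerSeries (ResField F z) :=
  binomialRoot (orderOf θ) (natCast_ne_zero_resField z hr) (classY F z)⁻¹

/-- The series `C_can · X` with coefficients in `K[X; θ] / N K[X; θ]`. -/
def imageX : PowerSeries (SkewQuot θ z) :=
  PowerSeries.map (resToQuot θ z) (seriesC z hr) *
    PowerSeries.C (Ideal.Quotient.mk (idealN θ z) (mono θ 1 1))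

variable (θ) in
/-- The constants `K → (K[X; θ] / N K[X; θ])[[T]]`. -/
def constK : K →+* PowerSeries (SkewQuot θ z) :=
  PowerSeries.C.comp ((Ideal.Quotient.mk (idealN θ z)).comp SkewMonoidAlgebra.singleOneRingHom)

variable (θ) in
theorem constK_apply (a : K) :
    constK θ z a = PowerSeries.C (Ideal.Quotient.mk (idealN θ z) (mono θ 0 a)) := rfl

variable (θ) in
theorem map_resToQuot_commutes (u : PowerSeries (ResField F z)) (v : PowerSeries (SkewQuot θ z)) :
    PowerSeries.map (resToQuot θ z) u * v = v * PowerSeries.map (resToQuot θ z) u := by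
  ext n
  rw [PowerSeries.coeff_mul, PowerSeries.coeff_mul, ← Finset.Nat.sum_antidiagonal_swap]
  refine Finset.sum_congr rfl fun p _ => ?_
  simp only [Prod.fst_swap, Prod.snd_swap, PowerSeries.coeff_map]
  exact resToQuot_commutes θ z _ _

theorem imageX_pow (n : ℕ) : imageX z hr ^ n =
    PowerSeries.map (resToQuot θ z) (seriesC z hr ^ n) *
      PowerSeries.C (Ideal.Quotient.mk (idealN θ z) (mono θ n 1)) := by
  induction n with
  | zero =>
    rw [pow_zero, pow_zero, map_one, one_mul, show mono θ 0 1 = 1 from rfl, map_one, map_one]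
  | succ n ih =>
    rw [pow_succ, ih, imageX, mul_assoc, ← mul_assoc (PowerSeries.C _),
      ← map_resToQuot_commutes θ z (seriesC z hr), mul_assoc, ← mul_assoc, ← map_mul, ← pow_succ,
      ← map_mul, ← map_mul, mono_mul_mono]
    simp

theorem imageX_rule (n : ℕ) (a : K) :
    constK θ z ((θ ^ n) a) * imageX z hr ^ n = imageX z hr ^ n * constK θ z a := by
  rw [imageX_pow, ← mul_assoc, ← map_resToQuot_commutes, mul_assoc, mul_assoc, constK_apply,
    constK_apply, ← map_mul, ← map_mul, ← map_mul, ← map_mul, mono_mul_mono, mono_mul_mono]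
  simp

/-- The canonical Taylor expansion of skew polynomials at `z`: the morphism of `K`-algebras
`τ_{z,can} : K[X; θ] → (K[X; θ] / N K[X; θ])[[T]]` with `X ↦ (1 + T / Y)^{1/r} X`. -/
def tauCan : SkewPoly θ →+* PowerSeries (SkewQuot θ z) :=
  SkewMonoidAlgebra.liftNCRingHom (constK θ z)
    (powersHom (PowerSeries (SkewQuot θ z)) (imageX z hr) :
      Multiplicative ℕ →* PowerSeries (SkewQuot θ z))
    (fun {a x} => imageX_rule z hr (expo θ x) a)

theorem tauCan_mono (n : ℕ) (a : K) :
    tauCan z hr (mono θ n a) = constK θ z a * imageX z hr ^ n :=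
  SkewMonoidAlgebra.liftNC_single _ _ _ _

/-- The defining property of admissible morphisms: `τ_{z,can}(Y) = Y + T`, where `Y` on the right
is the class of `Y` modulo `N`. -/
theorem tauCan_Y {z : Fs} (hz : z ≠ 0) :
    tauCan z hr (mono θ (orderOf θ) 1) =
      PowerSeries.map (resToQuot θ z) (PowerSeries.C (classY F z) + PowerSeries.X) := by
  have h1 : Ideal.Quotient.mk (idealN θ z) (mono θ (orderOf θ) 1) =
      resToQuot θ z (classY F z) := by
    rw [classY, AdjoinRoot.root, resToQuot_mk, ← monomial_one_one_eq_X, centre_monomial, one_mul,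
      map_one]
  rw [tauCan_mono, map_one, one_mul, imageX_pow, seriesC, (binomialRoot_spec _ _ _).2, h1,
    ← PowerSeries.map_C, ← map_mul, add_mul, one_mul, mul_right_comm, ← map_mul,
    inv_mul_cancel₀ (classY_ne_zero hz), map_one, one_mul]

/-- Laurent series with mapped coefficients. -/
def laurentMap {R S : Type*} [Semiring R] [Semiring S] (φ : R →+* S) :
    LaurentSeries R →+* LaurentSeries S where
  toFun x := HahnSeries.map x φ
  map_one' := HahnSeries.map_one φ.toMonoidWithZeroHom
  map_mul' x y := HahnSeries.map_mul (φ : R →ₙ+* S)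
  map_zero' := by ext; simp
  map_add' x y := by ext; simp

theorem laurentMap_C {R S : Type*} [Semiring R] [Semiring S] (φ : R →+* S) (a : R) :
    laurentMap φ (HahnSeries.C a) = HahnSeries.C (φ a) :=
  HahnSeries.map_C a φ

theorem laurentMap_T {R S : Type*} [Semiring R] [Semiring S] (φ : R →+* S) :
    laurentMap φ (HahnSeries.single 1 1) = HahnSeries.single 1 1 := by
  change HahnSeries.map (HahnSeries.single 1 1) φ = _
  ext n
  rw [HahnSeries.map_coeff, HahnSeries.coeff_single, HahnSeries.coeff_single]
  split_ifs
  · exact map_one φ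
  · exact map_zero φ

theorem tauCan_centre {z : Fs} (hz : z ≠ 0) (P : F[X]) :
    HahnSeries.ofPowerSeries ℤ _ (tauCan z hr (centre θ P)) =
      laurentMap (resToQuot θ z) (polyTaylor (classY F z) P) := by
  suffices h : ((HahnSeries.ofPowerSeries ℤ (SkewQuot θ z)).comp ((tauCan z hr).comp (centre θ))) =
      (laurentMap (resToQuot θ z)).comp (polyTaylor (classY F z)) from RingHom.congr_fun h P
  refine Polynomial.ringHom_ext (fun c => ?_) ?_
  · have h1 : polyTaylor (classY F z) (C c) = HahnSeries.C (algebraMap F (ResField F z) c) :=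
      eval₂_C _ _
    have h2 : resToQuot θ z (algebraMap F (ResField F z) c) =
        Ideal.Quotient.mk (idealN θ z) (mono θ 0 (algebraMap F K c)) := by
      rw [AdjoinRoot.algebraMap_eq, ← AdjoinRoot.mk_C, resToQuot_mk, ← monomial_zero_left,
        centre_monomial, Nat.zero_mul]
    rw [RingHom.comp_apply, RingHom.comp_apply, RingHom.comp_apply, h1, ← monomial_zero_left,
      centre_monomial, Nat.zero_mul, tauCan_mono, pow_zero, mul_one, constK_apply, ← h2,
      HahnSeries.ofPowerSeries_C, laurentMap_C]
  · have h1 : polyTaylor (classY F z) (X : F[X]) =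
        HahnSeries.C (classY F z) + HahnSeries.single 1 1 := eval₂_X _ _
    rw [RingHom.comp_apply, RingHom.comp_apply, RingHom.comp_apply, h1, ← monomial_one_one_eq_X,
      centre_monomial, one_mul, map_one, tauCan_Y hr hz, map_add, PowerSeries.map_C,
      PowerSeries.map_X, RingHom.map_add, RingHom.map_add, HahnSeries.ofPowerSeries_C, HahnSeries.ofPowerSeries_X,
      laurentMap_C, laurentMap_T]

/-- The canonical Taylor expansion of skew rational functions at `z`, the additive map
`TS_{z,can} : Frac(K[X; θ]) → (K[X; θ] / N K[X; θ])((T))`, `q ⊗ g ↦ q(Y + T) · τ_{z,can}(g)`. -/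
def taylorCan {z : Fs} (hz : z ≠ 0) : SkewFrac θ →+ LaurentSeries (SkewQuot θ z) :=
  TensorProduct.liftAddHom
    ((AddMonoidHom.mul.comp
      ((laurentMap (resToQuot θ z)).comp (ratTaylor (classY F z))).toAddMonoidHom).compl₂
      ((HahnSeries.ofPowerSeries ℤ (SkewQuot θ z)).comp (tauCan z hr)).toAddMonoidHom)
    (by
      intro P q g
      change laurentMap (resToQuot θ z) (ratTaylor (classY F z) (P • q)) *
          HahnSeries.ofPowerSeries ℤ _ (tauCan z hr g) =
        laurentMap (resToQuot θ z) (ratTaylor (classY F z) q) *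
          HahnSeries.ofPowerSeries ℤ _ (tauCan z hr (P • g))
      rw [smul_def', Algebra.smul_def, mul_comm (algebraMap _ _ P), map_mul, map_mul, map_mul,
        map_mul, ratTaylor_algebraMap, tauCan_centre hr hz, mul_assoc])

theorem taylorCan_tmul {z : Fs} (hz : z ≠ 0) (q : RatFunc F) (g : SkewPoly θ) :
    taylorCan hr hz (q ⊗ₜ g) = laurentMap (resToQuot θ z) (ratTaylor (classY F z) q) *
      HahnSeries.ofPowerSeries ℤ _ (tauCan z hr g) := rfl

/-- The canonical skew residue `sres_{z,can}(f)`: the coefficient of `T⁻¹` in `TS_{z,can}(f)`. -/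
def sresCan {z : Fs} (hz : z ≠ 0) (f : SkewFrac θ) : SkewQuot θ z :=
  (taylorCan hr hz f).coeff (-1)

end Canonical

section Partial

variable {F : Type u} {K : Type v} {Fs : Type w} [Field F] [Field K] [Algebra F K]
  [Field Fs] [Algebra F Fs] [IsSepClosure F Fs]

variable {θ : K ≃ₐ[F] K}

/-- The section operator `sec_j : Frac(K[X; θ]) → K(Y)`, the `F(Y)`-linear extension of
`sec_j : K[X; θ] → K[Y]`. -/
def secFrac (j : Fin (orderOf θ)) : SkewFrac θ →+ RatFunc K :=
  TensorProduct.liftAddHom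
    ((AddMonoidHom.mul.comp (ratMap F K).toAddMonoidHom).compl₂
      ((algebraMap K[X] (RatFunc K)).toAddMonoidHom.comp (sec θ j)))
    (by
      intro P q g
      change ratMap F K (P • q) * algebraMap K[X] (RatFunc K) (sec θ j g) =
        ratMap F K q * algebraMap K[X] (RatFunc K) (sec θ j (P • g))
      rw [smul_def', sec_centre_mul θ j.pos j j.isLt, Algebra.smul_def, map_mul, map_mul,
        ratMap_algebraMap]
      ring)

theorem secFrac_tmul (j : Fin (orderOf θ)) (q : RatFunc F) (g : SkewPoly θ) :
    secFrac j (q ⊗ₜ g) = ratMap F K q * algebraMap K[X] (RatFunc K) (sec θ j g) := rfl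

variable (F K) in
/-- The quotient ring `K[Y] / N K[Y]`. -/
abbrev CommQuot (z : Fs) : Type v :=
  K[X] ⧸ Ideal.span {(minpoly F z).map (algebraMap F K)}

/-- The section operator `sec_j : K[X; θ] / N K[X; θ] → K[Y] / N K[Y]` on the quotients. -/
def secQuot (j : Fin (orderOf θ)) (z : Fs) : SkewQuot θ z →+ CommQuot F K z :=
  QuotientAddGroup.lift (idealN θ z).toAddSubgroup
    ((Ideal.Quotient.mk _).toAddMonoidHom.comp (sec θ j)) (by
      intro f hf
      obtain ⟨g, rfl⟩ := (mem_idealN θ z).1 hf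
      change Ideal.Quotient.mk _ (sec θ j _) = 0
      rw [← centre_commutes, sec_centre_mul θ j.pos j j.isLt, Ideal.Quotient.eq_zero_iff_mem]
      exact Ideal.mul_mem_right _ _ (Ideal.mem_span_singleton_self _))

theorem secQuot_mk (j : Fin (orderOf θ)) (z : Fs) (g : SkewPoly θ) :
    secQuot j z (Ideal.Quotient.mk _ g) = Ideal.Quotient.mk _ (sec θ j g) := rfl

variable (F K) in
/-- The morphism `ι_z : K[Y] / N K[Y] → K ⊗_F Fs`, `a Yⁱ ↦ a ⊗ zⁱ`. -/
def iota (z : Fs) : CommQuot F K z →+* K ⊗[F] Fs :=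
  Ideal.Quotient.lift _
    (eval₂RingHom (Algebra.TensorProduct.includeLeftRingHom : K →+* K ⊗[F] Fs) (1 ⊗ₜ z)) (by
      intro P hP
      obtain ⟨Q, rfl⟩ := Ideal.mem_span_singleton'.1 hP
      have h : (eval₂RingHom (Algebra.TensorProduct.includeLeftRingHom : K →+* K ⊗[F] Fs)
          (1 ⊗ₜ z)).comp (mapRingHom (algebraMap F K)) =
          (Algebra.TensorProduct.includeRight : Fs →ₐ[F] K ⊗[F] Fs).toRingHom.comp
            (aeval z : F[X] →ₐ[F] Fs).toRingHom := by
        refine Polynomial.ringHom_ext (fun c => ?_) ?_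
        · simp
        · simp
      have h1 := RingHom.congr_fun h (minpoly F z)
      simp only [RingHom.comp_apply, coe_mapRingHom, AlgHom.toRingHom_eq_coe, RingHom.coe_coe,
        minpoly.aeval, map_zero] at h1
      rw [map_mul, h1, mul_zero])

/-- The canonical `j`-th partial skew residue `sres_{z,j,can}(f) ∈ K ⊗_F Fs`. -/
def psresCan (hr : (orderOf θ : F) ≠ 0) {z : Fs} (hz : z ≠ 0) (j : Fin (orderOf θ))
    (f : SkewFrac θ) : K ⊗[F] Fs :=
  iota F K z (secQuot j z (sresCan hr hz f))

theorem isAlgebraic_of_fixed (hθ : IsOfFinOrder θ)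
    (hF : ∀ a : K, θ a = a → a ∈ (algebraMap F K).range) : Algebra.IsAlgebraic F K := by
  have : Finite (Subgroup.zpowers θ) := (finite_zpowers.2 hθ).to_subtype
  have : Algebra.IsInvariant F K (Subgroup.zpowers θ) :=
    ⟨fun a h => hF a (h ⟨θ, Subgroup.mem_zpowers θ⟩)⟩
  have := Algebra.IsInvariant.isIntegral F K (Subgroup.zpowers θ)
  infer_instance

theorem natCast_ne_zero_of_not_dvd (θ : K ≃ₐ[F] K) (p : ℕ) [CharP K p] (hp : ¬ p ∣ orderOf θ) :
    (orderOf θ : F) ≠ 0 := by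
  intro h
  apply hp
  rw [← CharP.cast_eq_zero_iff K p, ← map_natCast (algebraMap F K), h, map_zero]

end Partial

end SkewRes

end

namespace SkewRes

/-! ### Invariance of the residue of a Laurent series under `T ↦ T u`. -/

section ChangeOfVariable

/-! Both sides are additive in `f`, so `f = q ⊗ a X^n` suffices. The series `(1 + T/Y)^{1/r}` has
central coefficients, so the skew residue of `f` is the coefficient of `T⁻¹` in `q(Y + T) (1 +
T/Y)^{n/r}`, times the class of `a X^n`. Under `Y ↦ z` that central factor becomes an ordinary
residue over `Fs` (`psresCan_tmul_mono`).

This residue is computed by the substitution `Y = y^r`. In local coordinates, `z + T` becomes `(ζ +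
T)^r`, that is `T ↦ T u` with `T u = (ζ + T)^r - ζ^r` and `u(0) = r ζ^{r-1} ≠ 0`. The root `(1 +
T/z)^{1/r}` becomes `(ζ + T)/ζ`, because both have constant term `1` and the same `r`-th power; the
Jacobian is `r (ζ + T)^{r-1}`. Hence the residue is `r ζ^{-n}` times that of `y^{n+r-1} q(y^r) dy`
at `ζ` (`coeff_ratTaylor_mul_binomialRoot`). If `n = j + r m`, then `sec_j(a X^n) = a Y^m` is
evaluated to `a ⊗ ζ^{rm}`, which turns `ζ^{-n}` into `ζ^{-j}`; otherwise both sides vanish.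

Invariance of residues (`coeff_laurentSubst_mul_derivative`) must hold in every characteristic. The
usual argument, that `dφ/φ^k` is exact for `k ≥ 2`, divides by `k - 1`; the division is therefore
made over `ℤ[x₀, x₁, …]` and the result specialized. -/

theorem coeff_pow_eq_coeff_mul_derivative_of_charZero {R : Type*} [CommRing R] [IsDomain R]
    [CharZero R] (v : PowerSeries R) (m : ℕ) :
    PowerSeries.coeff (m + 1) (v ^ (m + 1)) =
      PowerSeries.coeff m (v ^ m * PowerSeries.derivative R v) := by
  -- The coefficient of `T^m` in the derivative of `v^(m+1)`, found in two ways, gives the claim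
  -- multiplied by `m + 1`.
  have h := PowerSeries.coeff_derivative (v ^ (m + 1)) m
  rw [PowerSeries.derivative_pow, Nat.add_sub_cancel, mul_assoc, ← map_natCast PowerSeries.C,
    PowerSeries.coeff_C_mul, mul_comm, Nat.cast_succ] at h
  exact (mul_right_cancel₀ (Nat.cast_add_one_ne_zero m) h).symm

/-- Over any commutative ring, the identity obtained by dividing the derivative of `v ^ (m + 1)`
by `m + 1`. -/
theorem coeff_pow_eq_coeff_mul_derivative {R : Type*} [CommRing R] (v : PowerSeries R) (m : ℕ) :
    PowerSeries.coeff (m + 1) (v ^ (m + 1)) =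
      PowerSeries.coeff m (v ^ m * PowerSeries.derivative R v) := by
  -- The generic power series: its coefficients are independent variables over `ℤ`, and `e`
  -- specializes it to `v`.
  let V : PowerSeries (MvPolynomial ℕ ℤ) := PowerSeries.mk MvPolynomial.X
  let e : MvPolynomial ℕ ℤ →+* R :=
    MvPolynomial.eval₂Hom (Int.castRingHom R) fun n => PowerSeries.coeff n v
  have hV : PowerSeries.map e V = v := by
    ext n
    simp [V, e]
  have hd : PowerSeries.map e (PowerSeries.derivative _ V) = PowerSeries.derivative R v := by
    ext n
    rw [PowerSeries.coeff_map, PowerSeries.coeff_derivative, PowerSeries.coeff_derivative, map_mul,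
      ← PowerSeries.coeff_map, hV]
    simp
  have h := congrArg e (coeff_pow_eq_coeff_mul_derivative_of_charZero V m)
  rwa [← PowerSeries.coeff_map, ← PowerSeries.coeff_map, map_mul, map_pow (PowerSeries.map e),
    map_pow (PowerSeries.map e), hV, hd] at h

variable {L : Type*} [Field L]

theorem derivative_X_mul (u : PowerSeries L) :
    PowerSeries.derivative L (PowerSeries.X * u) =
      u + PowerSeries.X * PowerSeries.derivative L u := by
  rw [Derivation.leibniz, PowerSeries.derivative_X, smul_eq_mul, smul_eq_mul]
  ring

/-- With `φ = T u`, this says that `dφ / φ^(m+2)` has no residue. For `v = u⁻¹` one has `v' = -v²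
u'`, so the series is `v^(m+1) - T v^m v'`, and the preceding identity makes the two contributions
cancel. -/
theorem coeff_inv_pow_mul_derivative (u : PowerSeries L) (hu : PowerSeries.constantCoeff u ≠ 0)
    (m : ℕ) : PowerSeries.coeff (m + 1)
      (u⁻¹ ^ (m + 2) * PowerSeries.derivative L (PowerSeries.X * u)) = 0 := by
  have h : u⁻¹ ^ (m + 2) * PowerSeries.derivative L (PowerSeries.X * u) =
      u⁻¹ ^ (m + 1) - PowerSeries.X * (u⁻¹ ^ m * PowerSeries.derivative L u⁻¹) := by
    rw [derivative_X_mul, PowerSeries.derivative_inv', mul_add, pow_succ u⁻¹ (m + 1), mul_assoc,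
      PowerSeries.inv_mul_cancel u hu]
    ring
  rw [h, map_sub, PowerSeries.coeff_succ_X_mul, coeff_pow_eq_coeff_mul_derivative, sub_self]

theorem hasSubst_X_mul (u : PowerSeries L) : PowerSeries.HasSubst (PowerSeries.X * u) :=
  PowerSeries.HasSubst.of_constantCoeff_zero' (by simp)

/-- The substitution `T ↦ T u` on power series. -/
noncomputable def substMul (u : PowerSeries L) : PowerSeries L →+* PowerSeries L :=
  (PowerSeries.substAlgHom (R := L) (hasSubst_X_mul u)).toRingHom

theorem substMul_X (u : PowerSeries L) : substMul u PowerSeries.X = PowerSeries.X * u :=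
  PowerSeries.substAlgHom_X (R := L) (hasSubst_X_mul u)

theorem substMul_C (u : PowerSeries L) (a : L) :
    substMul u (PowerSeries.C a) = PowerSeries.C a :=
  (PowerSeries.substAlgHom (R := L) (hasSubst_X_mul u)).commutes a

theorem exists_eq_C_add_X_mul (g : PowerSeries L) :
    ∃ h, g = PowerSeries.C (PowerSeries.constantCoeff g) + PowerSeries.X * h := by
  obtain ⟨h, hh⟩ := PowerSeries.X_dvd_iff.2
    (show PowerSeries.constantCoeff (g - PowerSeries.C (PowerSeries.constantCoeff g)) = 0 by simp)
  exact ⟨h, by rw [← hh]; exact (add_sub_cancel _ _).symm⟩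

theorem constantCoeff_substMul (u g : PowerSeries L) :
    PowerSeries.constantCoeff (substMul u g) = PowerSeries.constantCoeff g := by
  obtain ⟨h, h2⟩ := exists_eq_C_add_X_mul g
  conv_lhs => rw [h2]
  rw [map_add, substMul_C, map_mul, substMul_X, map_add, map_mul, map_mul,
    PowerSeries.constantCoeff_C, PowerSeries.constantCoeff_X, zero_mul, zero_mul, add_zero]

/-- Invariance of the coefficient of `T^N` in `g`, seen as the residue of `g / T^(N + 1)`, under the
substitution `T ↦ T u`. -/
theorem coeff_substMul (u : PowerSeries L) (hu : PowerSeries.constantCoeff u ≠ 0)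
    (N : ℕ) (g : PowerSeries L) :
    PowerSeries.coeff N (u⁻¹ ^ (N + 1) * (substMul u g *
      PowerSeries.derivative L (PowerSeries.X * u))) = PowerSeries.coeff N g := by
  induction N generalizing g with
  | zero =>
    rw [PowerSeries.coeff_zero_eq_constantCoeff_apply, map_mul, map_mul,
      constantCoeff_substMul, derivative_X_mul, PowerSeries.coeff_zero_eq_constantCoeff_apply]
    simp
    field_simp
  | succ N ih =>
    -- The constant term of `g` contributes a multiple of the residue of `dφ / φ^(N+2)`, which is
    -- zero; the rest, `X h`, lowers the pole order by one. Only the simple pole of the base case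
    -- contributes.
    obtain ⟨h, h2⟩ := exists_eq_C_add_X_mul g
    have h3 : u⁻¹ ^ (N + 1 + 1) * (substMul u g *
        PowerSeries.derivative L (PowerSeries.X * u)) =
        PowerSeries.C (PowerSeries.constantCoeff g) *
          (u⁻¹ ^ (N + 2) * PowerSeries.derivative L (PowerSeries.X * u)) +
        PowerSeries.X * (u⁻¹ ^ (N + 1) * (substMul u h *
          PowerSeries.derivative L (PowerSeries.X * u))) := by
      conv_lhs => rw [h2]
      rw [map_add, substMul_C, map_mul, substMul_X]
      have h4 := PowerSeries.inv_mul_cancel u hu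
      generalize PowerSeries.derivative L (PowerSeries.X * u) = D
      linear_combination (PowerSeries.X * u⁻¹ ^ (N + 1) * substMul u h * D) * h4
    rw [h3, map_add, PowerSeries.coeff_C_mul, coeff_inv_pow_mul_derivative u hu, mul_zero, zero_add,
      PowerSeries.coeff_succ_X_mul, ih]
    conv_rhs => rw [h2]
    rw [map_add, PowerSeries.coeff_succ_X_mul, PowerSeries.coeff_C, if_neg (Nat.succ_ne_zero N),
      zero_add]

/-- The substitution `T ↦ T u` on power series, with values in Laurent series. -/
noncomputable def powerSubst (u : PowerSeries L) : PowerSeries L →+* LaurentSeries L :=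
  (HahnSeries.ofPowerSeries ℤ L).comp (substMul u)

theorem powerSubst_apply (u g : PowerSeries L) :
    powerSubst u g = HahnSeries.ofPowerSeries ℤ L (substMul u g) := rfl

theorem powerSubst_X (u : PowerSeries L) : powerSubst u PowerSeries.X =
    HahnSeries.ofPowerSeries ℤ L (PowerSeries.X * u) := by
  rw [powerSubst_apply, substMul_X]

variable {u : PowerSeries L} (hu : PowerSeries.constantCoeff u ≠ 0)

include hu in
theorem isUnit_powerSubst (y : Submonoid.powers (PowerSeries.X : PowerSeries L)) :
    IsUnit (powerSubst u y) := by
  obtain ⟨_, n, rfl⟩ := y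
  have h : u ≠ 0 := by rintro rfl; simp at hu
  simp only [map_pow, powerSubst_X]
  exact (isUnit_iff_ne_zero.2 (HahnSeries.ofPowerSeries_injective.ne_iff' (map_zero _) |>.2
    (mul_ne_zero PowerSeries.X_ne_zero h))).pow n

/-- The substitution `T ↦ T u` on Laurent series. -/
noncomputable def laurentSubst : LaurentSeries L →+* LaurentSeries L :=
  IsLocalization.lift (M := Submonoid.powers (PowerSeries.X : PowerSeries L))
    (g := powerSubst u) (isUnit_powerSubst hu)

theorem laurentSubst_ofPowerSeries (g : PowerSeries L) :
    laurentSubst hu (HahnSeries.ofPowerSeries ℤ L g) = powerSubst u g :=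
  IsLocalization.lift_eq (M := Submonoid.powers (PowerSeries.X : PowerSeries L)) _ g

/-- Invariance of the residue of Laurent series under the change of variable `T ↦ T u`. -/
theorem coeff_laurentSubst_mul_derivative (G : LaurentSeries L) :
    (laurentSubst hu G * HahnSeries.ofPowerSeries ℤ L
      (PowerSeries.derivative L (PowerSeries.X * u))).coeff (-1) = G.coeff (-1) := by
  obtain ⟨⟨g, _, n, rfl⟩, h⟩ := IsLocalization.surj
    (Submonoid.powers (PowerSeries.X : PowerSeries L)) G
  -- An extra factor `X` makes the exponent of the denominator positive, so that the residue of `G`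
  -- is the coefficient of `T^n` in the numerator.
  replace h : G * HahnSeries.ofPowerSeries ℤ L (PowerSeries.X ^ (n + 1)) =
      HahnSeries.ofPowerSeries ℤ L (g * PowerSeries.X) := by
    rw [pow_succ, map_mul, ← mul_assoc, map_mul]
    exact congrArg (· * _) h
  generalize g * PowerSeries.X = k at h
  have hs : ∀ m : ℕ, HahnSeries.single (-(m : ℤ)) (1 : L) *
      HahnSeries.ofPowerSeries ℤ L (PowerSeries.X ^ m) = 1 := by
    intro m
    rw [HahnSeries.ofPowerSeries_X_pow, HahnSeries.single_mul_single]
    simp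
  have hc : ∀ w : PowerSeries L, (HahnSeries.single (-((n + 1 : ℕ) : ℤ)) (1 : L) *
      HahnSeries.ofPowerSeries ℤ L w).coeff (-1) = PowerSeries.coeff n w := by
    intro w
    rw [HahnSeries.coeff_single_mul, one_mul, show (-1 : ℤ) - -((n + 1 : ℕ) : ℤ) = (n : ℤ) by
      push_cast; ring, HahnSeries.ofPowerSeries_apply_coeff]
  have hG : G = HahnSeries.single (-((n + 1 : ℕ) : ℤ)) (1 : L) *
      HahnSeries.ofPowerSeries ℤ L k := by
    rw [← h, mul_left_comm, hs, mul_one]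
  have hψ := congrArg (laurentSubst hu) h
  rw [map_mul, laurentSubst_ofPowerSeries, laurentSubst_ofPowerSeries, map_pow, powerSubst_X,
    ← map_pow, mul_pow] at hψ
  have hui : HahnSeries.ofPowerSeries ℤ L (u ^ (n + 1)) *
      HahnSeries.ofPowerSeries ℤ L (u⁻¹ ^ (n + 1)) = 1 := by
    rw [← map_mul, ← mul_pow, PowerSeries.mul_inv_cancel u hu, one_pow, map_one]
  have hψ2 : laurentSubst hu G = HahnSeries.single (-((n + 1 : ℕ) : ℤ)) (1 : L) *
      (HahnSeries.ofPowerSeries ℤ L (u⁻¹ ^ (n + 1)) * powerSubst u k) := by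
    rw [← hψ, map_mul]
    linear_combination (-laurentSubst hu G * (HahnSeries.ofPowerSeries ℤ L (u ^ (n + 1)) *
      HahnSeries.ofPowerSeries ℤ L (u⁻¹ ^ (n + 1)))) * hs (n + 1) - laurentSubst hu G * hui
  rw [hψ2, hG, mul_assoc, mul_assoc]
  rw [powerSubst_apply, ← map_mul, ← map_mul, hc, coeff_substMul u hu, hc]

end ChangeOfVariable

/-! ### The substitution `Y = y^r` near `ζ`. -/

section PowerMap

variable {F L : Type*} [Field F] [Field L] [Algebra F L]

theorem exists_X_mul_eq_add_pow_sub (r : ℕ) (hr : (r : L) ≠ 0) {ζ : L} (hζ : ζ ≠ 0) :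
    ∃ u : PowerSeries L, PowerSeries.constantCoeff u ≠ 0 ∧
      PowerSeries.X * u = (PowerSeries.C ζ + PowerSeries.X) ^ r - PowerSeries.C (ζ ^ r) := by
  obtain ⟨u, hu⟩ := PowerSeries.X_dvd_iff.2
    (show PowerSeries.constantCoeff
      ((PowerSeries.C ζ + PowerSeries.X) ^ r - PowerSeries.C (ζ ^ r)) = 0 by simp)
  refine ⟨u, ?_, hu.symm⟩
  -- The constant term of `u` is the derivative of `T u` at `0`, namely `r ζ^(r-1)`.
  have h := congrArg (fun f => PowerSeries.constantCoeff (PowerSeries.derivative L f)) hu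
  simp only [derivative_X_mul, map_sub, PowerSeries.derivative_pow, map_add,
    PowerSeries.derivative_C, PowerSeries.derivative_X] at h
  simp at h
  rw [← h]
  exact mul_ne_zero hr (pow_ne_zero _ hζ)

theorem substPow_algebraMap (r : ℕ) (hr : 0 < r) (P : F[X]) :
    substPow r hr (algebraMap F[X] (RatFunc F) P) =
      algebraMap F[X] (RatFunc F) (expand F r P) := by
  have := RatFunc.map_apply_div (expand F r : F[X] →+* F[X])
    (nonZeroDivisors_le_comap_nonZeroDivisors_of_injective _ (expand_injective hr)) P 1
  simpa [substPow, RatFunc.coe_mapRingHom_eq_coe_map] using this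

theorem polyTaylor_C (c : L) (a : F) :
    polyTaylor c (C a) = HahnSeries.C (algebraMap F L a) := eval₂_C _ _

theorem polyTaylor_X (c : L) :
    polyTaylor c (X : F[X]) = HahnSeries.C c + HahnSeries.single 1 1 := eval₂_X _ _

theorem ratFunc_ringHom_ext {R : Type*} [Semiring R] {f g : RatFunc F →+* R}
    (hC : ∀ a, f (algebraMap F[X] _ (C a)) = g (algebraMap F[X] _ (C a)))
    (hX : f (algebraMap F[X] _ X) = g (algebraMap F[X] _ X)) : f = g :=
  IsLocalization.ringHom_ext F[X]⁰ (Polynomial.ringHom_ext hC hX)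

theorem ofPowerSeries_C_add_X (c : L) :
    HahnSeries.ofPowerSeries ℤ L (PowerSeries.C c + PowerSeries.X) =
      HahnSeries.C c + HahnSeries.single 1 1 := by
  rw [map_add, HahnSeries.ofPowerSeries_C, HahnSeries.ofPowerSeries_X]

variable {r : ℕ} {ζ : L} {u : PowerSeries L} (hu : PowerSeries.constantCoeff u ≠ 0)
  (h : PowerSeries.X * u = (PowerSeries.C ζ + PowerSeries.X) ^ r - PowerSeries.C (ζ ^ r))

include h in
-- Two ring homomorphisms on `F(Y)` need only be compared on constants and on `Y`; there the claim
-- is `ζ^r + T u = (ζ + T)^r`.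
theorem laurentSubst_ratTaylor (hr : 0 < r) (q : RatFunc F) :
    laurentSubst hu (ratTaylor (ζ ^ r) q) = ratTaylor ζ (substPow r hr q) := by
  suffices H : (laurentSubst hu).comp (ratTaylor (F := F) (ζ ^ r)) =
      (ratTaylor ζ).comp (substPow r hr) from RingHom.congr_fun H q
  refine ratFunc_ringHom_ext (fun a => ?_) ?_
  · rw [RingHom.comp_apply, RingHom.comp_apply, substPow_algebraMap, expand_C,
      ratTaylor_algebraMap, ratTaylor_algebraMap, polyTaylor_C, polyTaylor_C,
      ← HahnSeries.ofPowerSeries_C, laurentSubst_ofPowerSeries, powerSubst_apply, substMul_C]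
  · rw [RingHom.comp_apply, RingHom.comp_apply, substPow_algebraMap, expand_X,
      ratTaylor_algebraMap, ratTaylor_algebraMap, map_pow, polyTaylor_X, polyTaylor_X,
      ← ofPowerSeries_C_add_X, ← ofPowerSeries_C_add_X, laurentSubst_ofPowerSeries,
      powerSubst_apply, map_add, substMul_C, substMul_X, h, add_sub_cancel, map_pow]

include h in
-- Both sides have constant term `1` and `r`-th power `(ζ + T)^r / ζ^r`, so uniqueness of the root
-- applies.
theorem substMul_binomialRoot (hr : (r : L) ≠ 0) (hζ : ζ ≠ 0) :
    substMul u (binomialRoot r hr (ζ ^ r)⁻¹) =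
      PowerSeries.C ζ⁻¹ * (PowerSeries.C ζ + PowerSeries.X) := by
  have hinv : (PowerSeries.C ζ⁻¹ : PowerSeries L) * PowerSeries.C ζ = 1 := by
    rw [← map_mul, inv_mul_cancel₀ hζ, map_one]
  have hinv' : (PowerSeries.C (ζ ^ r)⁻¹ : PowerSeries L) * PowerSeries.C (ζ ^ r) = 1 := by
    rw [← map_mul, inv_mul_cancel₀ (pow_ne_zero r hζ), map_one]
  refine seriesRoot_unique r hr _ _ ?_ ?_ ?_
  · rw [constantCoeff_substMul, (binomialRoot_spec r hr _).1]
  · simp [hζ]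
  · rw [← map_pow, (binomialRoot_spec r hr _).2, map_add, map_one, map_mul, substMul_C, substMul_X,
      h, mul_pow, ← map_pow, inv_pow]
    linear_combination -hinv'

/-- The change of variable `Y = y ^ r` in the residue of `q(Y) Y^(n / r) dY`. -/
theorem coeff_ratTaylor_mul_binomialRoot (hr : (r : L) ≠ 0) (hr0 : 0 < r) (hζ : ζ ≠ 0) (n : ℕ)
    (q : RatFunc F) :
    (ratTaylor (ζ ^ r) q *
      HahnSeries.ofPowerSeries ℤ L (binomialRoot r hr (ζ ^ r)⁻¹ ^ n)).coeff (-1) =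
      r * (ζ ^ n)⁻¹ * residue ζ (RatFunc.X ^ (n + r - 1) * substPow r hr0 q) := by
  obtain ⟨u, hu, h⟩ := exists_X_mul_eq_add_pow_sub r hr hζ
  have hd : PowerSeries.derivative L (PowerSeries.X * u) =
      PowerSeries.C (r : L) * (PowerSeries.C ζ + PowerSeries.X) ^ (r - 1) := by
    rw [h, map_sub, PowerSeries.derivative_pow, map_add, PowerSeries.derivative_C,
      PowerSeries.derivative_C, PowerSeries.derivative_X, map_natCast]
    ring
  have hX : ratTaylor ζ (RatFunc.X : RatFunc F) =
      HahnSeries.ofPowerSeries ℤ L (PowerSeries.C ζ + PowerSeries.X) := by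
    rw [← RatFunc.algebraMap_X, ratTaylor_algebraMap, polyTaylor_X, ofPowerSeries_C_add_X]
  have hc : HahnSeries.C ((r : L) * (ζ ^ n)⁻¹) =
      HahnSeries.ofPowerSeries ℤ L (PowerSeries.C (r : L) * PowerSeries.C ζ⁻¹ ^ n) := by
    rw [← map_pow, inv_pow, ← map_mul, HahnSeries.ofPowerSeries_C]
  -- The factor `r y^(r-1)` in the result is the Jacobian `hd`, and `y^n / ζ^n` is the image of the
  -- `n`-th power of the root.
  rw [← coeff_laurentSubst_mul_derivative hu, map_mul, laurentSubst_ratTaylor hu h hr0,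
    laurentSubst_ofPowerSeries, powerSubst_apply, map_pow, substMul_binomialRoot h hr hζ, hd]
  change _ = _ * (ratTaylor ζ _).coeff (-1)
  rw [← smul_eq_mul (r * (ζ ^ n)⁻¹ : L), ← HahnSeries.coeff_smul, ← HahnSeries.C_mul_eq_smul, hc,
    Nat.add_sub_assoc hr0, pow_add]
  congr 1
  simp only [map_mul, map_pow, hX]
  ring

end PowerMap

/-! ### From the skew residue to a commutative residue over `Fs`. -/

section Evaluation

variable {F K Fs : Type*} [Field F] [Field K] [Algebra F K]
  [Field Fs] [Algebra F Fs]

variable (F) in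
/-- The embedding of `F[Y] / N` in the separable closure with `Y ↦ z`. -/
noncomputable def resEval (z : Fs) : ResField F z →+* Fs :=
  AdjoinRoot.lift (algebraMap F Fs) z (show (minpoly F z).eval₂ _ z = 0 from minpoly.aeval F z)

theorem resEval_mk (z : Fs) (P : F[X]) :
    resEval F z (AdjoinRoot.mk (minpoly F z) P) = aeval z P :=
  AdjoinRoot.lift_mk _ _

theorem resEval_classY (z : Fs) : resEval F z (classY F z) = z :=
  AdjoinRoot.lift_root _

theorem laurentMap_ofPowerSeries {R S : Type*} [Semiring R] [Semiring S] (φ : R →+* S)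
    (f : PowerSeries R) : laurentMap φ (HahnSeries.ofPowerSeries ℤ R f) =
      HahnSeries.ofPowerSeries ℤ S (PowerSeries.map φ f) := by
  ext n
  change φ ((HahnSeries.ofPowerSeries ℤ R f).coeff n) = _
  rw [PowerSeries.coeff_coe, PowerSeries.coeff_coe, PowerSeries.coeff_map]
  split_ifs
  · exact map_zero φ
  · rfl

theorem iota_mk (z : Fs) (P : K[X]) : iota F K z (Ideal.Quotient.mk _ P) =
    eval₂ (Algebra.TensorProduct.includeLeftRingHom : K →+* K ⊗[F] Fs) (1 ⊗ₜ z) P := rfl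

theorem iota_mk_map (z : Fs) (P : F[X]) :
    iota F K z (Ideal.Quotient.mk _ (P.map (algebraMap F K))) = 1 ⊗ₜ aeval z P := by
  rw [iota_mk, eval₂_map]
  induction P using Polynomial.induction_on' with
  | add p q hp hq => rw [eval₂_add, hp, hq, map_add, TensorProduct.tmul_add]
  | monomial n c =>
    rw [eval₂_monomial, aeval_monomial, Algebra.TensorProduct.tmul_pow, one_pow,
      RingHom.comp_apply, Algebra.TensorProduct.includeLeftRingHom_apply,
      Algebra.TensorProduct.tmul_mul_tmul, one_mul, mul_one, Algebra.algebraMap_eq_smul_one,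
      TensorProduct.smul_tmul, ← Algebra.smul_def]

variable [IsSepClosure F Fs]

theorem laurentMap_ratTaylor (z : Fs) (q : RatFunc F) :
    laurentMap (resEval F z) (ratTaylor (classY F z) q) = ratTaylor z q := by
  suffices H : (laurentMap (resEval F z)).comp (ratTaylor (classY F z)) = ratTaylor (F := F) z from
    RingHom.congr_fun H q
  refine ratFunc_ringHom_ext (fun a => ?_) ?_
  · rw [RingHom.comp_apply, ratTaylor_algebraMap, ratTaylor_algebraMap, polyTaylor_C, polyTaylor_C,
      laurentMap_C, AdjoinRoot.algebraMap_eq, resEval, AdjoinRoot.lift_of]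
  · rw [RingHom.comp_apply, ratTaylor_algebraMap, ratTaylor_algebraMap, polyTaylor_X, polyTaylor_X,
      map_add, laurentMap_C, laurentMap_T, resEval_classY]

variable {θ : K ≃ₐ[F] K} (hr : (orderOf θ : F) ≠ 0)

theorem map_seriesC (z : Fs) (hr' : (orderOf θ : Fs) ≠ 0) :
    PowerSeries.map (resEval F z) (seriesC z hr) = binomialRoot (orderOf θ) hr' z⁻¹ := by
  have h := binomialRoot_spec (orderOf θ) (natCast_ne_zero_resField z hr) (classY F z)⁻¹
  have h' := binomialRoot_spec (orderOf θ) hr' z⁻¹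
  refine seriesRoot_unique _ hr' _ _ ?_ h'.1 ?_
  · rw [seriesC, ← PowerSeries.coeff_zero_eq_constantCoeff_apply, PowerSeries.coeff_map,
      PowerSeries.coeff_zero_eq_constantCoeff_apply, h.1, map_one]
  · rw [← map_pow, seriesC, h.2, h'.2, map_add, map_one, map_mul, PowerSeries.map_C,
      PowerSeries.map_X, map_inv₀, resEval_classY]

/-- The series `seriesC` has central coefficients, so the constant `a` moves past it and `a X^n`
splits off on the right as a coefficient independent of `T`. -/
theorem sresCan_tmul_mono {z : Fs} (hz : z ≠ 0) (q : RatFunc F) (n : ℕ) (a : K) :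
    sresCan hr hz (q ⊗ₜ mono θ n a) =
      resToQuot θ z ((ratTaylor (classY F z) q *
        HahnSeries.ofPowerSeries ℤ _ (seriesC z hr ^ n)).coeff (-1)) *
        Ideal.Quotient.mk (idealN θ z) (mono θ n a) := by
  have h : tauCan z hr (mono θ n a) = PowerSeries.map (resToQuot θ z) (seriesC z hr ^ n) *
      PowerSeries.C (Ideal.Quotient.mk (idealN θ z) (mono θ n a)) := by
    rw [tauCan_mono, imageX_pow, ← mul_assoc, ← map_resToQuot_commutes, mul_assoc, constK_apply,
      ← map_mul, ← map_mul, mono_mul_mono]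
    simp
  rw [sresCan, taylorCan_tmul, h, map_mul, ← laurentMap_ofPowerSeries, ← mul_assoc, ← map_mul,
    HahnSeries.ofPowerSeries_C, HahnSeries.C_apply, HahnSeries.coeff_mul_single_zero]
  rfl

/-- Both `sec_j` and `ι_z` are `F[Y]`-linear, with `Y` acting on `Fs` as `z`; central factors thus
pass to the right tensor factor. -/
theorem iota_secQuot (j : Fin (orderOf θ)) (z : Fs) (x : ResField F z) (g : SkewPoly θ) :
    iota F K z (secQuot j z (resToQuot θ z x * Ideal.Quotient.mk _ g)) =
      (1 ⊗ₜ resEval F z x) * iota F K z (Ideal.Quotient.mk _ (sec θ j g)) := by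
  obtain ⟨P, rfl⟩ := AdjoinRoot.mk_surjective x
  rw [resToQuot_mk, ← map_mul, secQuot_mk, sec_centre_mul θ j.pos j j.isLt, map_mul, map_mul,
    iota_mk_map, resEval_mk]

theorem psresCan_tmul_mono {z : Fs} (hz : z ≠ 0) (hr' : (orderOf θ : Fs) ≠ 0)
    (j : Fin (orderOf θ)) (q : RatFunc F) (n : ℕ) (a : K) :
    psresCan hr hz j (q ⊗ₜ mono θ n a) =
      (1 ⊗ₜ (ratTaylor z q * HahnSeries.ofPowerSeries ℤ _
        (binomialRoot (orderOf θ) hr' z⁻¹ ^ n)).coeff (-1)) *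
        iota F K z (Ideal.Quotient.mk _ (sec θ j (mono θ n a))) := by
  rw [psresCan, sresCan_tmul_mono, iota_secQuot, ← map_seriesC hr z hr', ← map_pow,
    ← laurentMap_ofPowerSeries, ← laurentMap_ratTaylor z q, ← map_mul]
  rfl

end Evaluation

/-! ### Residues after extension of scalars from `F` to `K`. -/

section Rho

variable {F K L : Type*} [Field F] [Field K] [Algebra F K] [Field L] [Algebra F L]

theorem rho_C_mul_ratMap (h : Algebra.IsAlgebraic F K) (c : L) (a : K) (q : RatFunc F) :
    rho h c (RatFunc.C a * ratMap F K q) = a ⊗ₜ residue c q := by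
  have : (scalarExtEquiv F K h).symm (RatFunc.C a * ratMap F K q) = a ⊗ₜ q :=
    (LinearEquiv.symm_apply_eq _).2 rfl
  rw [rho, LinearMap.comp_apply, LinearEquiv.coe_coe, this, LinearMap.lTensor_tmul]

theorem ratMap_X : ratMap F K RatFunc.X = RatFunc.X := by
  rw [← RatFunc.algebraMap_X, ratMap_algebraMap, map_X, RatFunc.algebraMap_X]

/-- Needed because `sec_j(f)` lies in `K(Y)`, while `rho` is computed on products of a constant of
`K` with a function over `F`. -/
theorem substPow_ratMap (r : ℕ) (hr : 0 < r) (q : RatFunc F) :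
    substPow r hr (ratMap F K q) = ratMap F K (substPow r hr q) := by
  suffices H : (substPow r hr).comp (ratMap F K) = (ratMap F K).comp (substPow r hr) from
    RingHom.congr_fun H q
  refine ratFunc_ringHom_ext (fun a => ?_) ?_
  · simp [-RatFunc.algebraMap_C, ratMap_algebraMap, substPow_algebraMap]
  · simp [-RatFunc.algebraMap_X, ratMap_algebraMap, substPow_algebraMap]

end Rho

end SkewRes

/-! ### The residue formula, checked on the generators `q ⊗ a X^n`. -/

theorem mainTheorem9 {F K Fs : Type*} [Field F] [Field K] [Algebra F K]
    [Field Fs] [Algebra F Fs] [IsSepClosure F Fs]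
    (θ : K ≃ₐ[F] K) (hθ : IsOfFinOrder θ)
    (hF : ∀ a : K, θ a = a → a ∈ (algebraMap F K).range)
    (p : ℕ) [CharP K p] (hp : ¬ p ∣ orderOf θ)
    (f : SkewRes.SkewFrac θ) (j : Fin (orderOf θ))
    (z : Fs) (hz : z ≠ 0) (ζ : Fs) (hζ : ζ ^ orderOf θ = z) :
    SkewRes.psresCan (SkewRes.natCast_ne_zero_of_not_dvd θ p hp) hz j f =
      (orderOf θ : K ⊗[F] Fs) * ((1 : K) ⊗ₜ[F] (ζ ^ (j : ℕ))⁻¹) *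
        SkewRes.rho (SkewRes.isAlgebraic_of_fixed hθ hF) ζ
          (RatFunc.X ^ ((j : ℕ) + orderOf θ - 1) *
            SkewRes.substPow (orderOf θ) hθ.orderOf_pos (SkewRes.secFrac j f)) := by
  open SkewRes in
  have hr := natCast_ne_zero_of_not_dvd θ p hp
  have hr' : (orderOf θ : Fs) ≠ 0 := by
    rw [← map_natCast (algebraMap F Fs)]
    exact (_root_.map_ne_zero _).2 hr
  have hζ0 : ζ ≠ 0 := by
    rintro rfl
    exact hz (by rw [← hζ, zero_pow hθ.orderOf_pos.ne'])
  have hadd : ∀ f g, psresCan hr hz j (f + g) = psresCan hr hz j f + psresCan hr hz j g := by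
    intro f g
    rw [psresCan, sresCan, map_add, HahnSeries.coeff_add, map_add, map_add]
    rfl
  induction f using TensorProduct.induction_on with
  | zero =>
    rw [map_zero, map_zero, mul_zero, map_zero, mul_zero]
    -- Additivity at `0 + 0` forces the value at `0` to be `0`.
    simpa using hadd 0 0
  | add f g hf hg => rw [hadd, hf, hg, map_add, map_add, mul_add, map_add, mul_add]
  | tmul q g =>
    induction g using mono_induction with
    | h0 =>
      rw [tmul_zero, map_zero, map_zero, mul_zero, map_zero, mul_zero]
      simpa using hadd 0 0
    | hadd f g hf hg =>
      rw [tmul_add, hadd, hf, hg, map_add, map_add, mul_add, map_add, mul_add]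
    | hm n a =>
      rw [psresCan_tmul_mono hr hz hr', secFrac_tmul, sec_mono]
      split_ifs with hn
      · obtain ⟨hjn, m, hm⟩ := hn
        obtain rfl : n = j + orderOf θ * m := by omega
        -- The power `y^(rm)` coming from `Y^m` is absorbed into the exponent, which becomes the `n
        -- + r - 1` of the commutative formula.
        have h1 : RatFunc.X ^ ((j : ℕ) + orderOf θ - 1) *
            substPow (orderOf θ) hθ.orderOf_pos (ratMap F K q *
              algebraMap K[X] (RatFunc K) (monomial m a)) =
            RatFunc.C a * ratMap F K (RatFunc.X ^ (j + orderOf θ * m + orderOf θ - 1) *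
              substPow (orderOf θ) hθ.orderOf_pos q) := by
          have h2 : (j : ℕ) + orderOf θ * m + orderOf θ - 1 =
              (j + orderOf θ - 1) + m * orderOf θ := by
            have := hθ.orderOf_pos
            rw [mul_comm]
            omega
          rw [map_mul, substPow_algebraMap, substPow_ratMap, map_mul, map_pow, ratMap_X,
            expand_monomial, ← C_mul_X_pow_eq_monomial, map_mul, map_pow, RatFunc.algebraMap_C,
            RatFunc.algebraMap_X, h2, pow_add]
          ring
        rw [hm, Nat.mul_div_cancel_left _ hθ.orderOf_pos, h1, rho_C_mul_ratMap, iota_mk,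
          eval₂_monomial, Algebra.TensorProduct.tmul_pow, one_pow,
          Algebra.TensorProduct.includeLeftRingHom_apply, ← nsmul_one, nsmul_eq_mul]
        subst hζ
        rw [coeff_ratTaylor_mul_binomialRoot hr' hθ.orderOf_pos hζ0,
          show (((orderOf θ : ℕ) : K ⊗[F] Fs)) = 1 ⊗ₜ (orderOf θ : Fs) from
            (map_natCast (Algebra.TensorProduct.includeRight : Fs →ₐ[F] K ⊗[F] Fs) _).symm]
        simp only [Algebra.TensorProduct.tmul_mul_tmul, one_mul, mul_one]
        -- What remains in `Fs` is `ζ^{-(j + rm)} · ζ^{rm} = ζ^{-j}`.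
        congr 1
        rw [← pow_mul, pow_add]
        field_simp
      -- Here `sec_j(a X^n) = 0`, so both sides vanish.
      · simp
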